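/- Let $d\in\{2,3\}$, let $\Omega\subset\mathbb R^d$ be a convex polygonal/polyhedral domain, $\mathcal T_h$ a conforming simplicial triangulation of $\Omega$, $\mathcal E_h$ its set of faces, $h_E$ the diameter of $E\in\mathcal E_h$, and $\bm n$ the outward unit normal of each element. Let $\alpha,Pe,\epsilon,T>0$, $k\ge 0$, $N\ge 1$, $\Delta t=T/N$, and let $\bm\beta\in C(\overline\Omega)^d$ be divergence-free in $\Omega$ (in the sense of distributions) with $\bm\beta\cdot\bm n=0$ on $\partial\Omega$. Let $$\bm V_h=\prod_{K\in\mathcal T_h}[\mathcal P^k(K)]^d,\qquad W_h=\prod_{K\in\mathcal T_h}\mathcal P^{k+1}(K),\qquad M_h=\prod_{E\in\mathcal E_h}\mathcal P^k(E)$$ be the spaces of discontinuous piecewise polynomials. Put $(w,v)_{\mathcal T_h}=\sum_K\int_K wv$, $\langle\zeta,\rho\rangle_{\partial\mathcal T_h}=\sum_K\int_{\partial K}\zeta\rho$, let $\Pi_k^\partial$ be the facewise $L^2$ projection onto $\mathcal P^k(E)$, and let $$\begin{aligned}\mathcal A(\bm q,u,\widehat u;\bm r,w,\mu)=\;&(\bm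 q,\bm r)_{\mathcal T_h}-(u,\nabla\cdot\bm r)_{\mathcal T_h}+\langle\widehat u,\bm r\cdot\bm n\rangle_{\partial\mathcal T_h}+(\nabla\cdot\bm q,w)_{\mathcal T_h}-\langle\bm q\cdot\bm n,\mu\rangle_{\partial\mathcal T_h}\\&+\alpha\langle h_E^{-1}(\Pi_k^\partial u-\widehat u),\Pi_k^\partial w-\mu\rangle_{\partial\mathcal T_h},\end{aligned}$$ $$\mathcal B(u,\widehat u;w)=-(\bm\beta u,\nabla w)_{\mathcal T_h}+\langle\bm\beta\cdot\bm n\,\widehat u,w\rangle_{\partial\mathcal T_h}.$$ Then the following hold. 1. For every $u^0\in L^2(\Omega)$ there is a unique $u_h^0\in W_h$ with $(u_h^0,w_3)_{\mathcal T_h}-(u^0,w_3)_{\mathcal T_h}=0$ for all $w_3\in W_h$. 2. For each $1\le n\le N$ and every given $(u_h^{n-1},\widehat u_h^{\,n-1})\in W_h\times M_h$, there is exactly one $(\bm p_h^n,\phi_h^n,\widehat\phi_h^{\,n},\bm q_h^n,u_h^n,\widehat u_h^{\,n})\in(\bm V_h\times W_h\times M_h)^2$ such that $$\Big(\frac{u_h^n-u_h^{n-1}}{\Delta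 t},w_1\Big)_{\mathcal T_h}+\frac1{Pe}\mathcal A(\bm p_h^n,\phi_h^n,\widehat\phi_h^{\,n};\bm r_1,w_1,\mu_1)+\mathcal B(u_h^{n-1},\widehat u_h^{\,n-1};w_1)=0,$$ $$\big((u_h^n)^3-u_h^{n-1},w_2\big)_{\mathcal T_h}+\epsilon^2\mathcal A(\bm q_h^n,u_h^n,\widehat u_h^{\,n};\bm r_2,w_2,\mu_2)-(\phi_h^n,w_2)_{\mathcal T_h}=0$$ for all $(\bm r_1,w_1,\mu_1),(\bm r_2,w_2,\mu_2)\in\bm V_h\times W_h\times M_h$. -/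

import Mathlib

open MeasureTheory Set
open scoped InnerProductSpace Gradient ContDiff

noncomputable section

namespace HDG

/-- `ℝ^d` with its Euclidean structure. -/
abbrev Sp (d : ℕ) := EuclideanSpace ℝ (Fin d)

/-! ### Domain, mesh and velocity field -/

/-- A convex polygonal (`d = 2`) or polyhedral (`d = 3`) domain. -/
structure IsConvexPolytopalDomain {d : ℕ} (Ω : Set (Sp d)) : Prop where
  isOpen : IsOpen Ω
  nonempty : Ω.Nonempty
  convex : Convex ℝ Ω
  polytopal : ∃ S : Finset (Sp d), closure Ω = convexHull ℝ (S : Set (Sp d))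

/-- A triangulation of `Ω`: a finite geometric simplicial complex filling the closure of `Ω`.
Simplices are given by their sets of vertices. -/
structure Triangulation (d : ℕ) (Ω : Set (Sp d)) extends
    Geometry.SimplicialComplex ℝ (Sp d) where
  finite_faces : faces.Finite
  space_eq : toSimplicialComplex.space = closure Ω

/-- The velocity field `β` is continuous on the closure of `Ω`, divergence-free in `Ω` (in the sense
of distributions) and satisfies `β · n = 0` on the boundary. The last condition is expressed with
all outward normal vectors of the convex set `Ω` at a boundary point; at points in the relative
interior of a facet these are the nonnegative multiples of the outward unit normal, and for a
continuous `β` the conditions at the other points follow from those. -/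
structure IsAdmissibleVelocity {d : ℕ} (Ω : Set (Sp d)) (β : Sp d → Sp d) : Prop where
  continuousOn : ContinuousOn β (closure Ω)
  solenoidal : ∀ ψ : Sp d → ℝ, ContDiff ℝ ∞ ψ → HasCompactSupport ψ → tsupport ψ ⊆ Ω →
    ∫ x in Ω, ⟪β x, ∇ ψ x⟫_ℝ = 0
  no_penetration : ∀ x ∈ frontier Ω, ∀ ν : Sp d, (∀ y ∈ Ω, ⟪ν, y - x⟫_ℝ ≤ 0) → ⟪β x, ν⟫_ℝ = 0

/-! ### Polynomial spaces -/

/-- Polynomial functions on `ℝ^d` of total degree at most `m`. -/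
def polyFun (d m : ℕ) : Submodule ℝ (Sp d → ℝ) where
  carrier := {f | ∃ p : MvPolynomial (Fin d) ℝ, p.totalDegree ≤ m ∧
    ∀ x, f x = MvPolynomial.eval (fun i => x i) p}
  zero_mem' := ⟨0, by simp, by simp⟩
  add_mem' := by
    rintro f g ⟨p, hp, hf⟩ ⟨q, hq, hg⟩
    exact ⟨p + q, (MvPolynomial.totalDegree_add p q).trans (max_le hp hq), fun x => by
      simp [hf x, hg x]⟩
  smul_mem' := by
    rintro c f ⟨p, hp, hf⟩
    exact ⟨c • p, (MvPolynomial.totalDegree_smul_le c p).trans hp, fun x => by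
      simp [hf x, MvPolynomial.smul_eval]⟩

/-- Vector fields on `ℝ^d` all of whose components are polynomials of degree at most `m`. -/
def polyField (d m : ℕ) : Submodule ℝ (Sp d → Sp d) where
  carrier := {v | ∀ i, (fun x => v x i) ∈ polyFun d m}
  zero_mem' := fun _ => (polyFun d m).zero_mem
  add_mem' := fun hv hw i => (polyFun d m).add_mem (hv i) (hw i)
  smul_mem' := fun c _ hv i => (polyFun d m).smul_mem c (hv i)

/-- `P^m(S)` for a set `S`: the functions on `S` that are restrictions of polynomials of degree at
most `m`. A function on `S` is represented by its extension by zero to `ℝ^d`, so two elements are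
equal exactly if they are equal at all points of `S`. -/
def polyOn {d : ℕ} (m : ℕ) (S : Set (Sp d)) : Submodule ℝ (Sp d → ℝ) where
  carrier := {f | ∃ g ∈ polyFun d m, f = S.indicator g}
  zero_mem' := ⟨0, (polyFun d m).zero_mem, by simp⟩
  add_mem' := by
    rintro _ _ ⟨f, hf, rfl⟩ ⟨g, hg, rfl⟩
    exact ⟨f + g, (polyFun d m).add_mem hf hg, (Set.indicator_add' S f g).symm⟩
  smul_mem' := by
    rintro c _ ⟨f, hf, rfl⟩
    exact ⟨c • f, (polyFun d m).smul_mem c hf, (Set.indicator_const_smul S c f).symm⟩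

/-- The divergence `∑ i, ∂ᵢ vᵢ` of a vector field. -/
def divergence {d : ℕ} (v : Sp d → Sp d) (x : Sp d) : ℝ :=
  ∑ i, (fderiv ℝ v x (EuclideanSpace.single i 1)) i

/-! ### Geometry of a simplex -/

/-- The closed simplex with vertex set `S`. -/
def hull {d : ℕ} (S : Finset (Sp d)) : Set (Sp d) := convexHull ℝ (S : Set (Sp d))

/-- The barycenter of the simplex with vertex set `S`. -/
def barycenter {d : ℕ} (S : Finset (Sp d)) : Sp d := (S.card : ℝ)⁻¹ • ∑ v ∈ S, v

/-- The outward unit normal of the `d`-simplex `K` on its facet `F`: the vector from the barycenter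
of `K` to the barycenter of `F`, projected onto the orthogonal complement of the direction of `F`,
and normalized. -/
def outwardNormal {d : ℕ} (K F : Finset (Sp d)) : Sp d :=
  let w := (vectorSpan ℝ (F : Set (Sp d)))ᗮ.starProjection (barycenter F - barycenter K)
  ‖w‖⁻¹ • w

/-- The integral over the face `F` against the `(d-1)`-dimensional surface measure. -/
def faceIntegral {d : ℕ} (F : Finset (Sp d)) (g : Sp d → ℝ) : ℝ :=
  ∫ x in hull F, g x ∂(Measure.euclideanHausdorffMeasure (d - 1))

/-- The `L²` projection `Π_k^∂ f` of (the trace of) `f` onto `P^k(F)`: the element `g` of `P^k(F)`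
with `⟨g, ρ⟩_F = ⟨f, ρ⟩_F` for all `ρ ∈ P^k(F)`. -/
def faceProj {d : ℕ} (k : ℕ) (F : Finset (Sp d)) (f : Sp d → ℝ) : Sp d → ℝ :=
  Classical.epsilon fun g => g ∈ polyOn k (hull F) ∧
    ∀ ρ ∈ polyOn k (hull F), faceIntegral F (fun x => g x * ρ x) = faceIntegral F (fun x => f x * ρ x)

namespace Triangulation

variable {d : ℕ} {Ω : Set (Sp d)} (T : Triangulation d Ω)

/-- The elements of the mesh: its `d`-dimensional simplices. -/
def Element : Type := {K : Finset (Sp d) // K ∈ T.faces ∧ K.card = d + 1}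

/-- The faces of the mesh: the `(d-1)`-dimensional faces of its elements. -/
def Face : Type := {F : Finset (Sp d) // F.card = d ∧ ∃ K : T.Element, F ⊆ K.1}

instance : Finite T.Element :=
  (T.finite_faces.subset (t := {K | K ∈ T.faces ∧ K.card = d + 1}) fun _ h => h.1).to_subtype

instance : Finite T.Face := by
  have h : {F : Finset (Sp d) | F.card = d ∧ ∃ K : T.Element, F ⊆ K.1} ⊆
      ⋃ K : T.Element, {F | F ⊆ K.1} := fun F hF => mem_iUnion.2 hF.2
  exact ((finite_iUnion fun K : T.Element =>
    (K.1.powerset.finite_toSet.subset fun F hF => by simpa using hF)).subset h).to_subtype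

instance : Fintype T.Element := Fintype.ofFinite _

instance : Fintype T.Face := Fintype.ofFinite _

/-! ### Discrete inner products -/

/-- `(w, v)_{T_h}` for elementwise given scalar functions. -/
def scalarInner (w v : T.Element → Sp d → ℝ) : ℝ :=
  ∑ K, ∫ x in hull K.1, w K x * v K x

/-- `(w, v)_{T_h}` for elementwise given vector fields. -/
def vectorInner (w v : T.Element → Sp d → Sp d) : ℝ :=
  ∑ K, ∫ x in hull K.1, ⟪w K x, v K x⟫_ℝ

open Classical in
/-- `∑_K ∫_{∂K} g`, the boundary of each element `K` being the union of its faces; on the face `F`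
of `K` the integrand is `g K F`. -/
def bdry (g : T.Element → T.Face → Sp d → ℝ) : ℝ :=
  ∑ K : T.Element, ∑ F : T.Face with F.1 ⊆ K.1, faceIntegral F.1 (g K F)

/-! ### Finite element spaces

A discontinuous piecewise polynomial function is given by its restrictions to the elements; as the
elements have nonempty interior, a polynomial function on an element is the same as a polynomial
function on `ℝ^d`. A function on the skeleton is given by its restrictions to the faces. -/

/-- `V_h`: piecewise polynomial vector fields of degree at most `k`. -/
def V (k : ℕ) : Submodule ℝ (T.Element → Sp d → Sp d) :=
  Submodule.pi univ fun _ => polyField d k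

/-- `W_h`: piecewise polynomial functions of degree at most `k + 1`. -/
def W (k : ℕ) : Submodule ℝ (T.Element → Sp d → ℝ) :=
  Submodule.pi univ fun _ => polyFun d (k + 1)

/-- `M_h`: facewise polynomial functions of degree at most `k`, single-valued on every face. -/
def M (k : ℕ) : Submodule ℝ (T.Face → Sp d → ℝ) :=
  Submodule.pi univ fun F => polyOn k (hull F.1)

/-! ### The HDG forms -/

/-- The form `A(q, u, û; r, w, μ)` with stabilization parameter `α / h_F` on the face `F`, where
`h_F` is the diameter of `F`. -/
def formA (k : ℕ) (α : ℝ) (q : T.Element → Sp d → Sp d) (u : T.Element → Sp d → ℝ)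
    (uhat : T.Face → Sp d → ℝ) (r : T.Element → Sp d → Sp d) (w : T.Element → Sp d → ℝ)
    (μ : T.Face → Sp d → ℝ) : ℝ :=
  T.vectorInner q r
    - T.scalarInner u (fun K => divergence (r K))
    + T.bdry (fun K F x => uhat F x * ⟪r K x, outwardNormal K.1 F.1⟫_ℝ)
    + T.scalarInner (fun K => divergence (q K)) w
    - T.bdry (fun K F x => ⟪q K x, outwardNormal K.1 F.1⟫_ℝ * μ F x)
    + α * T.bdry (fun K F x => (Metric.diam (hull F.1))⁻¹ *
        (faceProj k F.1 (u K) x - uhat F x) * (faceProj k F.1 (w K) x - μ F x))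

/-- The convection form `B(u, û; w) = -(β u, ∇w)_{T_h} + ⟨β · n û, w⟩_{∂T_h}`. -/
def formB (β : Sp d → Sp d) (u : T.Element → Sp d → ℝ) (uhat : T.Face → Sp d → ℝ)
    (w : T.Element → Sp d → ℝ) : ℝ :=
  - T.vectorInner (fun K x => u K x • β x) (fun K x => ∇ (w K) x)
    + T.bdry (fun K F x => ⟪β x, outwardNormal K.1 F.1⟫_ℝ * uhat F x * w K x)

/-- The unknowns of one time step. -/
structure Unknowns (k : ℕ) where
  p : T.V k
  φ : T.W k
  φhat : T.M k
  q : T.V k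
  u : T.W k
  uhat : T.M k

/-- One time step of the fully discrete HDG scheme: `s` solves the nonlinear system with
previous values `uPrev`, `uhatPrev` and step size `Δt`. -/
structure IsStepSolution (k : ℕ) (α Pe ε Δt : ℝ) (β : Sp d → Sp d)
    (uPrev : T.W k) (uhatPrev : T.M k) (s : T.Unknowns k) : Prop where
  evolution : ∀ (r : T.V k) (w : T.W k) (μ : T.M k),
    T.scalarInner (fun K x => (s.u.1 K x - uPrev.1 K x) / Δt) w.1
      + 1 / Pe * T.formA k α s.p.1 s.φ.1 s.φhat.1 r.1 w.1 μ.1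
      + T.formB β uPrev.1 uhatPrev.1 w.1 = 0
  potential : ∀ (r : T.V k) (w : T.W k) (μ : T.M k),
    T.scalarInner (fun K x => s.u.1 K x ^ 3 - uPrev.1 K x) w.1
      + ε ^ 2 * T.formA k α s.q.1 s.u.1 s.uhat.1 r.1 w.1 μ.1
      - T.scalarInner s.φ.1 w.1 = 0

/-- `u₀h ∈ W_h` is the discrete initial value of the scheme for the initial datum `u₀`:
`(u₀h, w)_{T_h} = (u₀, w)_{T_h}` for all `w ∈ W_h`. -/
def IsInitialValue (k : ℕ) (u₀ : Sp d → ℝ) (u₀h : T.W k) : Prop :=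
  ∀ w : T.W k, T.scalarInner u₀h.1 w.1 - T.scalarInner (fun _ => u₀) w.1 = 0

end Triangulation

end HDG

end

noncomputable section

namespace HDG

/-! ### Stationary points in finite dimension -/

section Abstract

variable {E : Type*} [AddCommGroup E] [Module ℝ E] [FiniteDimensional ℝ E]

/-! On the diagonal the coupling terms of A cancel, leaving ‖q‖² plus the weighted square of Πu − û.
So A is positive semidefinite, definite in (q, û) when u = 0, and symmetric up to the sign of the
flux (`isMixedForm_bilinA`). Flux and trace can then be eliminated, which leaves a symmetric
positive semidefinite form a on W_h (`IsMixedForm.exists_elimination`). As B is evaluated at the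
previous step, it is a mere linear functional of the test function, and a time step reads m(u,w) + c
a(φ,w) = l(w), DG(u)w + e a(u,w) = m(φ,w). Here m is the L² product, c = Δt/Pe, e = ε², and G(u) = ∫
(u⁴/4 − p u), with p the previous u, is convex and bounded below.

Existence (`exists_stationary`): the first equation makes u an affine function of φ, and after
substitution the second is, modulo ker a, the stationarity of a convex function of φ. This function
is minimized over a complement of ker a, where it is coercive; the second equation then fixes all of
φ.

Uniqueness (`IsMixedForm.existsUnique`): testing the differences of both equations with the
differences of the solutions gives a vanishing sum of nonnegative terms; strict monotonicity of the
cube and definiteness of A finish.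

Concretely, all this rests on continuous functions of zero L² norm vanishing on simplices and faces
(`isCell_hull`, `IsCell.eqOn_zero`). The initial value is the Riesz representative of the datum for
the L² product on W_h. -/

theorem exists_riesz (m : E →ₗ[ℝ] E →ₗ[ℝ] ℝ) (hm : ∀ x, m x x = 0 → x = 0) :
    ∃ R : (E →ₗ[ℝ] ℝ) →ₗ[ℝ] E, ∀ l, m (R l) = l := by
  have hinj : Function.Injective m := by
    rw [injective_iff_map_eq_zero]
    intro x hx
    exact hm x (by simp [hx])
  have hfin : Module.finrank ℝ E = Module.finrank ℝ (E →ₗ[ℝ] ℝ) :=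
    (Subspace.dual_finrank_eq (K := ℝ) (V := E)).symm
  refine ⟨(LinearEquiv.ofInjectiveOfFinrankEq m hinj hfin).symm, fun l => ?_⟩
  exact (LinearEquiv.ofInjectiveOfFinrankEq m hinj hfin).apply_symm_apply l

omit [FiniteDimensional ℝ E] in
/-- A positive semidefinite form vanishes on the diagonal only on its kernel. -/
theorem eq_zero_of_diag_eq_zero (a : E →ₗ[ℝ] E →ₗ[ℝ] ℝ) (hsymm : ∀ x y, a x y = a y x)
    (hnonneg : ∀ x, 0 ≤ a x x) {x : E} (hx : a x x = 0) : a x = 0 := by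
  ext y
  by_contra h
  replace h : a x y ≠ 0 := h
  have key : ∀ t : ℝ, 0 ≤ 2 * t * a x y + a y y := fun t => by
    have := hnonneg (t • x + y)
    simp only [map_add, map_smul, LinearMap.add_apply, LinearMap.smul_apply, smul_eq_mul, hx,
      hsymm y x] at this
    linarith
  -- Since `a x x = 0`, the quadratic in `t` is affine; at this `t` it equals −1.
  have := key (-(a y y + 1) / (2 * a x y))
  have e : 2 * (-(a y y + 1) / (2 * a x y)) * a x y = -(a y y + 1) := by
    field_simp
  linarith

/-- Minimizing a convex function plus the square of a norm. -/
theorem exists_min_convex_add_posdef (a : E →ₗ[ℝ] E →ₗ[ℝ] ℝ) (hsymm : ∀ x y, a x y = a y x)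
    (hnonneg : ∀ x, 0 ≤ a x x) (hdef : ∀ x, a x x = 0 → x = 0) {G : E → ℝ}
    (hG : ConvexOn ℝ univ G) {b : ℝ} (hb : ∀ x, b ≤ G x) {c : ℝ} (hc : 0 < c) :
    ∃ x, ∀ y, G x + c * a x x ≤ G y + c * a y y := by
  -- With `a` as the inner product, the quadratic term is a multiple of ‖x‖², hence coercive; in
  -- finite dimension the convex `G` is continuous.
  let core : InnerProductSpace.Core ℝ E :=
    { inner := fun x y => a x y
      conj_inner_symm := fun x y => by simpa using hsymm y x
      re_inner_nonneg := fun x => by simpa using hnonneg x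
      add_left := fun x y z => by simp
      smul_left := fun x y r => by simp
      definite := fun x hx => hdef x hx }
  let : NormedAddCommGroup E := core.toNormedAddCommGroup
  let : InnerProductSpace ℝ E := InnerProductSpace.ofCore core.toCore
  have hnorm : ∀ x : E, a x x = ‖x‖ ^ 2 := fun x => (real_inner_self_eq_norm_sq x)
  have hcont : Continuous G := by
    rw [← continuousOn_univ]
    exact hG.continuousOn isOpen_univ
  have : ProperSpace E := FiniteDimensional.proper ℝ E
  simp only [hnorm]
  refine Continuous.exists_forall_le (by fun_prop) ?_
  refine Filter.tendsto_atTop_mono (fun x => add_le_add_left (hb x) _) ?_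
  refine Filter.tendsto_atTop_add_const_left _ _ (Filter.Tendsto.const_mul_atTop hc ?_)
  exact (Filter.tendsto_pow_atTop two_ne_zero).comp tendsto_norm_cocompact_atTop

/-- With L representing `a` through `m`, the first equation is u = f − cLφ. Minimizing G(f − cLψ) +
(c/2) a(ψ,ψ) over ψ in a complement of ker a yields u. The minimizer ψ need not be φ: the two only
have to agree under `a`, and φ is read off from the second equation. -/
theorem exists_stationary (m a : E →ₗ[ℝ] E →ₗ[ℝ] ℝ) (hmsymm : ∀ x y, m x y = m y x)
    (hmdef : ∀ x, m x x = 0 → x = 0) (hsymm : ∀ x y, a x y = a y x)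
    (hnonneg : ∀ x, 0 ≤ a x x) {G : E → ℝ} (hG : ConvexOn ℝ univ G) {b : ℝ} (hb : ∀ x, b ≤ G x)
    (DG : E → E →ₗ[ℝ] ℝ)
    (hDG : ∀ u w, HasDerivAt (fun t : ℝ => G (u + t • w)) (DG u w) 0) {c : ℝ} (hc : 0 < c)
    (l : E →ₗ[ℝ] ℝ) :
    ∃ u φ : E, (∀ w, m u w + c * a φ w = l w) ∧ ∀ w, DG u w = m φ w := by
  obtain ⟨R, hR⟩ := exists_riesz m hmdef
  obtain ⟨C, hC⟩ := Submodule.exists_isCompl (LinearMap.ker a)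
  let L : E →ₗ[ℝ] E := R ∘ₗ a
  have hL : ∀ x w, m (L x) w = a x w := fun x w => by simp [L, hR]
  let f := R l
  have hf : ∀ w, m f w = l w := fun w => by simp [f, hR]
  let aC : C →ₗ[ℝ] C →ₗ[ℝ] ℝ := a.compl₁₂ C.subtype C.subtype
  have haC : ∀ x y : C, aC x y = a x y := fun x y => rfl
  let g : C →ᵃ[ℝ] E := AffineMap.const ℝ C f + ((-c) • (L ∘ₗ C.subtype)).toAffineMap
  have hg : ∀ x : C, g x = f - c • L x := fun x => by simp [g, sub_eq_add_neg]
  have hGg : ConvexOn ℝ univ (G ∘ g) := by simpa using hG.comp_affineMap g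
  obtain ⟨ψ, hψ⟩ := exists_min_convex_add_posdef aC (fun x y => hsymm _ _) (fun x => hnonneg _)
    (fun x hx => by
      have h1 := eq_zero_of_diag_eq_zero a hsymm hnonneg hx
      have h2 : (x : E) ∈ LinearMap.ker a ⊓ C := ⟨h1, x.2⟩
      rw [hC.inf_eq_bot] at h2
      simpa using h2)
    hGg (fun x => hb _) (half_pos hc)
  let u := f - c • L ψ
  -- This makes the second equation hold by definition; what remains is that `φ` and `ψ` agree under
  -- `a`.
  let φ := R (DG u)
  have hφ : ∀ w, m φ w = DG u w := fun w => by simp [φ, hR]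
  have hstatC : ∀ η : C, a φ η = a ψ η := by
    intro η
    have hd1 : HasDerivAt (fun t : ℝ => G (u + t • (-c • L η))) (DG u (-c • L η)) 0 := hDG _ _
    have hd2 : HasDerivAt (fun t : ℝ => c / 2 * (a ψ ψ + 2 * t * a ψ η + t ^ 2 * a η η))
        (c / 2 * (2 * a ψ η)) 0 := by
      have h := ((((hasDerivAt_id (0 : ℝ)).const_mul 2).mul_const (a ψ η)).const_add (a ψ ψ)).add
        (((hasDerivAt_id (0 : ℝ)).pow 2).mul_const (a η η))
      convert! h.const_mul (c / 2) using 1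
      simp
    have hmin : IsLocalMin ((fun t : ℝ => G (u + t • (-c • L η))) +
        fun t : ℝ => c / 2 * (a ψ ψ + 2 * t * a ψ η + t ^ 2 * a η η)) 0 := by
      refine Filter.Eventually.of_forall fun t => ?_
      have h := hψ (ψ + t • η)
      have e1 : u + t • (-c • L η) = f - c • L ((ψ + t • η : C) : E) := by
        simp only [u, Submodule.coe_add, Submodule.coe_smul, map_add, map_smul]
        module
      have e2 : a ψ ψ + 2 * t * a ψ η + t ^ 2 * a η η = aC (ψ + t • η) (ψ + t • η) := by
        simp only [haC, map_add, map_smul,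
          LinearMap.add_apply, LinearMap.smul_apply, smul_eq_mul, hsymm η ψ]
        ring
      simp only [Function.comp, hg] at h
      simp only [Pi.add_apply, e1, e2]
      simpa [u, haC] using h
    have h0 := hmin.hasDerivAt_eq_zero (hd1.add hd2)
    -- DG(u)(Lη) = m(φ, Lη) = m(Lη, φ) = a(η, φ), so the Euler–Lagrange equation compares `φ` with
    -- `ψ`.
    have h1 : DG u (L η) = a φ η := by
      rw [← hφ, hmsymm, hL, hsymm]
    simp only [map_smul, smul_eq_mul, h1] at h0
    have : c * (a φ η - a ψ η) = 0 := by linarith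
    rcases mul_eq_zero.1 this with h | h
    · exact absurd h hc.ne'
    · linarith
  have hstat : ∀ w, a φ w = a ψ w := by
    intro w
    have hw : w ∈ LinearMap.ker a ⊔ C := by rw [hC.sup_eq_top]; trivial
    obtain ⟨y, hy, z, hz, rfl⟩ := Submodule.mem_sup.1 hw
    have hy0 : ∀ x, a x y = 0 := fun x => by rw [hsymm, LinearMap.mem_ker.1 hy]; rfl
    simp [hy0, hstatC ⟨z, hz⟩]
  refine ⟨u, φ, fun w => ?_, fun w => (hφ w).symm⟩
  simp only [u, map_sub, map_smul, LinearMap.sub_apply, LinearMap.smul_apply, smul_eq_mul, hL, hf,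
    hstat]
  ring

end Abstract

/-! ### Mixed formulations -/

section Mixed

variable {V W M : Type*} [AddCommGroup V] [Module ℝ V] [FiniteDimensional ℝ V]
  [AddCommGroup W] [Module ℝ W] [FiniteDimensional ℝ W]
  [AddCommGroup M] [Module ℝ M] [FiniteDimensional ℝ M]

/-- The structure of a stabilized mixed form: positive semidefinite, definite in the flux and the
trace, and symmetric up to the sign of the flux. -/
structure IsMixedForm (A : V × W × M →ₗ[ℝ] V × W × M →ₗ[ℝ] ℝ) : Prop where
  nonneg : ∀ x, 0 ≤ A x x
  definite : ∀ q μ, A (q, 0, μ) (q, 0, μ) = 0 → q = 0 ∧ μ = 0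
  symm : ∀ q u l r w μ, A (q, u, l) (-r, w, μ) = A (r, w, μ) (-q, u, l)

omit [FiniteDimensional ℝ W] in
/-- Elimination of the flux and of the trace. -/
theorem IsMixedForm.exists_elimination {A : V × W × M →ₗ[ℝ] V × W × M →ₗ[ℝ] ℝ}
    (hA : IsMixedForm A) :
    ∃ (S : W →ₗ[ℝ] V × W × M) (a : W →ₗ[ℝ] W →ₗ[ℝ] ℝ), (∀ u, (S u).2.1 = u) ∧
      (∀ u y, A (S u) y = a u y.2.1) ∧ (∀ u w, a u w = a w u) ∧ ∀ u, 0 ≤ a u u := by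
  let i : V × M →ₗ[ℝ] V × W × M :=
    LinearMap.prod (LinearMap.fst ℝ V M) (LinearMap.prod 0 (LinearMap.snd ℝ V M))
  let j : W →ₗ[ℝ] V × W × M := LinearMap.prod 0 (LinearMap.prod LinearMap.id 0)
  have hi : ∀ z, i z = (z.1, 0, z.2) := fun z => rfl
  have hj : ∀ w, j w = (0, w, 0) := fun w => rfl
  obtain ⟨R, hR⟩ := exists_riesz (A.compl₁₂ i i) (fun z hz => by
    obtain ⟨h1, h2⟩ := hA.definite z.1 z.2 hz
    exact Prod.ext h1 h2)
  -- `S u` is `u` completed by the flux and trace that annihilate A against all tests with zero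
  -- W-component.
  let S : W →ₗ[ℝ] V × W × M := j - i ∘ₗ R ∘ₗ (A.compl₁₂ j i)
  let a : W →ₗ[ℝ] W →ₗ[ℝ] ℝ := A.compl₁₂ S j
  have hS : ∀ u, (S u).2.1 = u := fun u => by simp [S, hi, hj]
  have hSi : ∀ u z, A (S u) (i z) = 0 := by
    intro u z
    have h := LinearMap.congr_fun (hR (A.compl₁₂ j i u)) z
    simp only [LinearMap.compl₁₂_apply] at h
    simp [S, h]
  have hSa : ∀ u y, A (S u) y = a u y.2.1 := by
    intro u y
    have hy : y = j y.2.1 + i (y.1, y.2.2) := by simp [hi, hj]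
    conv_lhs => rw [hy, map_add, hSi, add_zero]
    rfl
  refine ⟨S, a, hS, hSa, fun u w => ?_, fun u => ?_⟩
  -- `A (S u)` sees only the W-component of its test, so the flux sign in the symmetry of A is
  -- harmless.
  · have h : A (S u) (-(S w).1, (S w).2.1, (S w).2.2) = A (S w) (-(S u).1, (S u).2.1, (S u).2.2) :=
      hA.symm _ _ _ _ _ _
    rw [hSa, hSa] at h
    simpa only [hS] using h
  · have h := hA.nonneg (S u)
    rwa [hSa, hS] at h

/-- Existence applies `exists_stationary` to the reduced form, with (e/2) a(u,u) absorbed into `G`.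
Uniqueness is an energy argument: in the sum of the two tested equations the mixed `m`-terms cancel.
-/
theorem IsMixedForm.existsUnique {A : V × W × M →ₗ[ℝ] V × W × M →ₗ[ℝ] ℝ}
    (hA : IsMixedForm A) (m : W →ₗ[ℝ] W →ₗ[ℝ] ℝ) (hmsymm : ∀ x y, m x y = m y x)
    (hmdef : ∀ x, m x x = 0 → x = 0) {G : W → ℝ} (hG : ConvexOn ℝ univ G) {b : ℝ}
    (hb : ∀ x, b ≤ G x) (DG : W → W →ₗ[ℝ] ℝ)
    (hDG : ∀ u w, HasDerivAt (fun t : ℝ => G (u + t • w)) (DG u w) 0)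
    (hmono : ∀ u v, 0 ≤ DG u (u - v) - DG v (u - v))
    (hstrict : ∀ u v, DG u (u - v) - DG v (u - v) = 0 → u = v)
    {c e : ℝ} (hc : 0 < c) (he : 0 < e) (l : W →ₗ[ℝ] ℝ) :
    ∃! s : (V × W × M) × (V × W × M),
      (∀ y, m s.2.2.1 y.2.1 + c * A s.1 y = l y.2.1) ∧
      ∀ y, DG s.2.2.1 y.2.1 + e * A s.2 y - m s.1.2.1 y.2.1 = 0 := by
  obtain ⟨S, a, hS, hSa, hasymm, hanonneg⟩ := hA.exists_elimination
  refine existsUnique_of_exists_of_unique ?_ ?_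
  · have hquad : ConvexOn ℝ univ fun u => e / 2 * a u u := by
      refine ⟨convex_univ, fun x _ y _ s t hs ht hst => ?_⟩
      have h := hanonneg (x - y)
      simp only [map_sub, map_add, map_smul, LinearMap.add_apply, LinearMap.sub_apply,
        LinearMap.smul_apply, smul_eq_mul, hasymm y x] at h ⊢
      obtain rfl : t = 1 - s := by linarith
      -- The convexity defect of the quadratic is (e/2) s(1−s) a(x−y, x−y).
      have := mul_nonneg (mul_nonneg (mul_nonneg he.le hs) ht) h
      nlinarith
    obtain ⟨u, φ, h1, h2⟩ := exists_stationary m a hmsymm hmdef hasymm hanonneg (hG.add hquad)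
      (b := b) (fun x => by
        have := mul_nonneg (half_pos he).le (hanonneg x)
        have := hb x
        simp only [Pi.add_apply]
        linarith)
      (fun u => DG u + e • a u) (fun u w => by
        refine (hDG u w).add ?_
        have h := ((((hasDerivAt_id (0 : ℝ)).const_mul 2).mul_const (a u w)).const_add (a u u)).add
          (((hasDerivAt_id (0 : ℝ)).pow 2).mul_const (a w w))
        convert! h.const_mul (e / 2) using 1
        · ext t
          simp only [map_add, map_smul, LinearMap.add_apply, LinearMap.smul_apply, smul_eq_mul,
            hasymm w u, Pi.add_apply, Pi.pow_apply, id]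
          ring
        · simp
          ring) hc l
    refine ⟨(S φ, S u), fun y => ?_, fun y => ?_⟩
    · simpa only [hS, hSa] using h1 y.2.1
    · have := h2 y.2.1
      simp only [LinearMap.add_apply, LinearMap.smul_apply, smul_eq_mul] at this
      simp only [hS, hSa]
      linarith
  · rintro ⟨x, z⟩ ⟨x', z'⟩ ⟨h1, h2⟩ ⟨h1', h2'⟩
    simp only at h1 h2 h1' h2'
    have k1 := fun y => (h1 y).trans (h1' y).symm
    have k2 := fun y => (h2 y).trans (h2' y).symm
    have k1x := k1 (x - x')
    have k2z := k2 (z - z')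
    have p1 := mul_nonneg hc.le (hA.nonneg (x - x'))
    have p2 := mul_nonneg he.le (hA.nonneg (z - z'))
    have p3 := hmono z.2.1 z'.2.1
    have hs1 := hmsymm (z - z').2.1 (x - x').2.1
    simp only [map_sub, LinearMap.sub_apply, Prod.fst_sub, Prod.snd_sub] at k1x k2z p1 p2 p3 hs1
    -- Adding `k1x` and `k2z` leaves the monotonicity term plus the two A-terms equal to zero, so
    -- each vanishes.
    have huz : z.2.1 = z'.2.1 := hstrict _ _ (by
      simp only [map_sub]
      linarith)
    have hz0 : A (z - z') (z - z') = 0 := by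
      have : e * A (z - z') (z - z') = 0 := by
        simp only [map_sub, LinearMap.sub_apply]
        rw [huz] at k2z k1x hs1 p3
        linarith
      exact (mul_eq_zero.1 this).resolve_left he.ne'
    have hx0 : A (x - x') (x - x') = 0 := by
      have : c * A (x - x') (x - x') = 0 := by
        simp only [map_sub, LinearMap.sub_apply]
        rw [huz] at k1x
        linarith
      exact (mul_eq_zero.1 this).resolve_left hc.ne'
    have fin : ∀ y y' : V × W × M, y.2.1 = y'.2.1 → A (y - y') (y - y') = 0 → y = y' := by
      rintro ⟨q, u, l⟩ ⟨q', u', l'⟩ h h0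
      obtain rfl : u = u' := h
      simp only [Prod.mk_sub_mk, sub_self] at h0
      obtain ⟨g1, g2⟩ := hA.definite _ _ h0
      rw [sub_eq_zero.1 g1, sub_eq_zero.1 g2]
    obtain rfl := fin z z' huz hz0
    -- A is definite only for zero W-component, so φ needs the second equation, whose other terms
    -- now agree; the test is the difference of the two φ.
    have hxx : x.2.1 = x'.2.1 := by
      have h := k2 (0, x.2.1 - x'.2.1, 0)
      refine sub_eq_zero.1 (hmdef _ ?_)
      simp only [map_sub, LinearMap.sub_apply] at h ⊢
      linarith
    rw [fin x x' hxx hx0]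

end Mixed

/-! ### Integration of continuous functions over compact cells -/

section Cells

variable {X : Type*} [TopologicalSpace X] [T2Space X] [MeasurableSpace X] [BorelSpace X]

/-- A compact set of finite measure all of whose nonempty relatively open subsets have positive
measure. -/
structure IsCell (μ : Measure X) (S : Set X) : Prop where
  isCompact : IsCompact S
  measure_ne_top : μ S ≠ ⊤
  measure_pos : ∀ U, IsOpen U → (U ∩ S).Nonempty → 0 < μ (U ∩ S)

omit [T2Space X] [MeasurableSpace X] [BorelSpace X] in
/-- Real functions on `X` that are continuous on `S`. -/
def contOn (S : Set X) : Subalgebra ℝ (X → ℝ) where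
  carrier := {f | ContinuousOn f S}
  mul_mem' := fun hf hg => ContinuousOn.mul hf hg
  add_mem' := fun hf hg => ContinuousOn.add hf hg
  algebraMap_mem' := fun _ => continuousOn_const

variable {μ : Measure X} {S : Set X}

theorem IsCell.integrableOn (hS : IsCell μ S) {f : X → ℝ} (hf : ContinuousOn f S) :
    IntegrableOn f S μ :=
  hf.integrableOn_of_subset_isCompact hS.isCompact hS.isCompact.measurableSet subset_rfl
    hS.measure_ne_top

/-- The points of `S` where `f` is nonzero form a relatively open null set, which must be empty in a
cell. -/
theorem IsCell.eqOn_zero (hS : IsCell μ S) {f : X → ℝ} (hf : ContinuousOn f S)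
    (hnonneg : ∀ x ∈ S, 0 ≤ f x) (hint : ∫ x in S, f x ∂μ = 0) : ∀ x ∈ S, f x = 0 := by
  have hae : f =ᵐ[μ.restrict S] 0 := by
    rwa [← setIntegral_eq_zero_iff_of_nonneg_ae _ (hS.integrableOn hf)]
    exact (ae_restrict_iff' hS.isCompact.measurableSet).2 (Filter.Eventually.of_forall hnonneg)
  by_contra! h
  obtain ⟨x, hx, hfx⟩ := h
  obtain ⟨U, hU, hUS⟩ := continuousOn_iff'.1 hf {0}ᶜ isClosed_singleton.isOpen_compl
  have hxU : x ∈ U ∩ S := hUS ▸ ⟨hfx, hx⟩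
  refine (hS.measure_pos U hU ⟨x, hxU⟩).ne' ?_
  have h0 := (ae_restrict_iff' hS.isCompact.measurableSet).1 hae
  refine measure_mono_null (fun y hy => ?_) (ae_iff.1 h0)
  have hy' : y ∈ f ⁻¹' {0}ᶜ ∩ S := hUS ▸ hy
  simpa using ⟨hy'.2, hy'.1⟩

/-- The integral over a cell as a linear functional. -/
def IsCell.integral (hS : IsCell μ S) : contOn S →ₗ[ℝ] ℝ where
  toFun f := ∫ x in S, f.1 x ∂μ
  map_add' f g := integral_add (hS.integrableOn f.2) (hS.integrableOn g.2)
  map_smul' c _ := integral_const_mul c _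

/-- The `L²` inner product over a cell. -/
def IsCell.inner (hS : IsCell μ S) : contOn S →ₗ[ℝ] contOn S →ₗ[ℝ] ℝ :=
  (LinearMap.mul ℝ (contOn S)).compr₂ hS.integral

theorem IsCell.inner_eq (hS : IsCell μ S) (f g : contOn S) : hS.inner f g = hS.integral (f * g) :=
  rfl

theorem IsCell.inner_apply (hS : IsCell μ S) (f g : contOn S) :
    hS.inner f g = ∫ x in S, f.1 x * g.1 x ∂μ := rfl

theorem IsCell.inner_comm (hS : IsCell μ S) (f g : contOn S) : hS.inner f g = hS.inner g f := by
  rw [inner_eq, inner_eq, mul_comm]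

theorem IsCell.integral_nonneg (hS : IsCell μ S) {f : contOn S} (hf : ∀ x ∈ S, 0 ≤ f.1 x) :
    0 ≤ hS.integral f :=
  setIntegral_nonneg hS.isCompact.measurableSet hf

theorem IsCell.integral_mono (hS : IsCell μ S) {f g : contOn S} (h : ∀ x ∈ S, f.1 x ≤ g.1 x) :
    hS.integral f ≤ hS.integral g :=
  setIntegral_mono_on (hS.integrableOn f.2) (hS.integrableOn g.2) hS.isCompact.measurableSet h

theorem IsCell.inner_self_nonneg (hS : IsCell μ S) (f : contOn S) : 0 ≤ hS.inner f f :=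
  hS.integral_nonneg fun _ _ => mul_self_nonneg _

theorem IsCell.eqOn_zero_of_inner_self (hS : IsCell μ S) {f : contOn S} (hf : hS.inner f f = 0) :
    ∀ x ∈ S, f.1 x = 0 := fun x hx => by
  simpa using hS.eqOn_zero (f.2.mul f.2) (fun x _ => mul_self_nonneg _) hf x hx

end Cells

/-! ### Simplices are cells -/

/-- A simplex of dimension `n` is a cell for the `n`-dimensional Hausdorff measure. -/
theorem isCell_hull {d n : ℕ} {F : Finset (Sp d)}
    (hF : AffineIndependent ℝ ((↑) : F → Sp d)) (hcard : F.card = n + 1) :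
    IsCell (Measure.euclideanHausdorffMeasure n) (hull F) := by
  obtain ⟨p, hp⟩ : F.Nonempty := Finset.card_pos.1 (by omega)
  let D := vectorSpan ℝ (F : Set (Sp d))
  have hD : Module.finrank ℝ D = n := by
    have h := hF.finrank_vectorSpan (n := n) (by simpa using hcard)
    rwa [Subtype.range_coe_subtype] at h
  -- Translation by `p` is an isometry of the direction space, where the Hausdorff measure is
  -- Lebesgue measure and the simplex is full-dimensional.
  let ι : D →ᵃ[ℝ] Sp d := D.subtype.toAffineMap + AffineMap.const ℝ D p
  have hι : ∀ x : D, ι x = x + p := fun x => rfl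
  have hiso : Isometry ι := Isometry.of_dist_eq fun x y => by
    rw [hι, hι, dist_add_right]; rfl
  let v : F → D := fun x => ⟨x - p, vsub_mem_vectorSpan ℝ x.2 hp⟩
  have hιv : ι ∘ v = ((↑) : F → Sp d) := by
    ext1 x; simp [hι, v]
  have hv : AffineIndependent ℝ v := AffineIndependent.of_comp ι (by rwa [hιv])
  let S := convexHull ℝ (range v)
  have himage : hull F = ι '' S := by
    rw [AffineMap.image_convexHull, ← range_comp, hιv, Subtype.range_coe_subtype]
    rfl
  have hSint : (interior S).Nonempty := by
    rw [interior_convexHull_nonempty_iff_affineSpan_eq_top,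
      hv.affineSpan_eq_top_iff_card_eq_finrank_add_one, hD]
    simpa using hcard
  have hScomp : IsCompact S := (finite_range v).isCompact_convexHull ℝ
  have hvol : (Measure.euclideanHausdorffMeasure n : Measure D) = volume := by
    rw [← hD]
    exact InnerProductSpace.euclideanHausdorffMeasure_eq_volume
  refine ⟨himage ▸ hScomp.image hiso.continuous, ?_, fun U hU hne => ?_⟩
  · rw [himage, hiso.euclideanHausdorffMeasure_image, hvol]
    exact hScomp.measure_ne_top
  · have hpre : U ∩ hull F = ι '' (ι ⁻¹' U ∩ S) := by
      rw [himage, image_preimage_inter]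
    have hne' : (ι ⁻¹' U ∩ S).Nonempty := by
      rw [hpre] at hne
      exact hne.of_image
    have hopen : IsOpen (ι ⁻¹' U) := hU.preimage hiso.continuous
    rw [hpre, hiso.euclideanHausdorffMeasure_image, hvol]
    obtain ⟨x, hxU, hxS⟩ := hne'
    -- A convex set with interior points lies in the closure of its interior, so an open set meeting
    -- `S` meets `interior S`.
    have hx : x ∈ closure (interior S) := by
      rw [(convex_convexHull ℝ _).closure_interior_eq_closure_of_nonempty_interior hSint]
      exact subset_closure hxS
    have := (hopen.inter isOpen_interior).measure_pos volume (mem_closure_iff.1 hx _ hopen hxU)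
    exact this.trans_le (measure_mono (inter_subset_inter_right _ interior_subset))

/-- A nondegenerate `d`-simplex in `ℝ^d` has nonempty interior. -/
theorem interior_hull_nonempty {d : ℕ} {K : Finset (Sp d)}
    (hK : AffineIndependent ℝ ((↑) : K → Sp d)) (hcard : K.card = d + 1) :
    (interior (hull K)).Nonempty := by
  have h := hK.affineSpan_eq_top_iff_card_eq_finrank_add_one
  rw [Subtype.range_coe_subtype] at h
  refine interior_convexHull_nonempty_iff_affineSpan_eq_top.2 (h.2 ?_)
  simpa using hcard

theorem diam_hull_pos {d : ℕ} {F : Finset (Sp d)} (hF : 2 ≤ F.card) :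
    0 < Metric.diam (hull F) := by
  obtain ⟨x, hx, y, hy, hxy⟩ := Finset.one_lt_card.1 hF
  have hsub : (F : Set (Sp d)) ⊆ hull F := subset_convexHull ℝ _
  exact (dist_pos.2 hxy).trans_le (Metric.dist_le_diam_of_mem
    (F.finite_toSet.isCompact_convexHull ℝ).isBounded (hsub hx) (hsub hy))

/-! ### Polynomial functions -/

section Polynomials

variable {d m : ℕ}

theorem analyticOnNhd_of_mem_polyFun {f : Sp d → ℝ} (hf : f ∈ polyFun d m) :
    AnalyticOnNhd ℝ f univ := by
  obtain ⟨p, -, hp⟩ := hf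
  have h := (AnalyticOnNhd.eval_mvPolynomial (𝕜 := ℝ) p).comp
    ((EuclideanSpace.equiv (Fin d) ℝ).toContinuousLinearMap.analyticOnNhd univ)
    (fun _ _ => mem_univ _)
  exact h.congr isOpen_univ fun x _ => (hp x).symm

theorem contDiff_of_mem_polyFun {f : Sp d → ℝ} (hf : f ∈ polyFun d m) : ContDiff ℝ ω f :=
  contDiffOn_univ.1 ((analyticOnNhd_of_mem_polyFun hf).contDiffOn uniqueDiffOn_univ)

theorem continuous_of_mem_polyFun {f : Sp d → ℝ} (hf : f ∈ polyFun d m) : Continuous f :=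
  (contDiff_of_mem_polyFun hf).continuous

theorem differentiable_of_mem_polyFun {f : Sp d → ℝ} (hf : f ∈ polyFun d m) :
    Differentiable ℝ f :=
  (contDiff_of_mem_polyFun hf).differentiable (by simp)

theorem contDiff_of_mem_polyField {v : Sp d → Sp d} (hv : v ∈ polyField d m) : ContDiff ℝ ω v :=
  contDiff_euclidean.2 fun i => contDiff_of_mem_polyFun (hv i)

/-- A polynomial function vanishing on a set with nonempty interior is zero. -/
theorem eq_zero_of_mem_polyFun {f : Sp d → ℝ} (hf : f ∈ polyFun d m) {S : Set (Sp d)}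
    (hS : (interior S).Nonempty) (h : ∀ x ∈ S, f x = 0) : f = 0 := by
  obtain ⟨x, hx⟩ := hS
  refine (analyticOnNhd_of_mem_polyFun hf).eq_of_eventuallyEq analyticOnNhd_const (z₀ := x) ?_
  filter_upwards [mem_interior_iff_mem_nhds.1 hx] with y hy using h y hy

theorem continuousOn_of_mem_polyOn {S : Set (Sp d)} {f : Sp d → ℝ} (hf : f ∈ polyOn m S) :
    ContinuousOn f S := by
  obtain ⟨g, hg, rfl⟩ := hf
  exact (continuous_of_mem_polyFun hg).continuousOn.congr fun x hx => indicator_of_mem hx g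

/-- An element of `polyOn m S` vanishing on `S` is zero. -/
theorem eq_zero_of_mem_polyOn {S : Set (Sp d)} {f : Sp d → ℝ} (hf : f ∈ polyOn m S)
    (h : ∀ x ∈ S, f x = 0) : f = 0 := by
  obtain ⟨g, hg, rfl⟩ := hf
  ext x
  by_cases hx : x ∈ S
  · exact h x hx
  · exact indicator_of_notMem hx g

instance : FiniteDimensional ℝ (polyFun d m) := by
  let ev : MvPolynomial (Fin d) ℝ →ₗ[ℝ] Sp d → ℝ :=
    LinearMap.pi fun x => (MvPolynomial.aeval (fun i => x i)).toLinearMap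
  have h : polyFun d m = (MvPolynomial.restrictTotalDegree (Fin d) ℝ m).map ev := by
    ext f
    simp only [Submodule.mem_map, MvPolynomial.mem_restrictTotalDegree]
    refine exists_congr fun p => and_congr_right fun _ => ?_
    simp only [funext_iff, ev, LinearMap.pi_apply, AlgHom.toLinearMap_apply,
      MvPolynomial.aeval_eq_eval]
    exact forall_congr' fun x => eq_comm
  rw [h]
  infer_instance

instance : FiniteDimensional ℝ (polyField d m) :=
  Module.Finite.of_injective
    (LinearMap.pi fun i => LinearMap.codRestrict (polyFun d m)
      ((LinearMap.pi fun x => (EuclideanSpace.proj i).toLinearMap ∘ₗ LinearMap.proj x) ∘ₗ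
        (polyField d m).subtype) fun v => v.2 i)
    fun v w h => by
      ext x i
      exact congrFun (congrArg Subtype.val (congrFun h i)) x

instance {S : Set (Sp d)} : FiniteDimensional ℝ (polyOn m S) := by
  let L : (Sp d → ℝ) →ₗ[ℝ] Sp d → ℝ :=
    { toFun := S.indicator
      map_add' := indicator_add' S
      map_smul' := indicator_const_smul S }
  have h : polyOn m S = (polyFun d m).map L := by
    ext f
    exact exists_congr fun g => and_congr_right fun _ => eq_comm
  rw [h]
  infer_instance

end Polynomials

theorem finiteDimensional_pi {ι : Type*} [Finite ι] {φ : ι → Type*} [∀ i, AddCommGroup (φ i)]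
    [∀ i, Module ℝ (φ i)] (p : ∀ i, Submodule ℝ (φ i)) [∀ i, FiniteDimensional ℝ (p i)] :
    FiniteDimensional ℝ (Submodule.pi univ p) :=
  Module.Finite.of_injective
    (LinearMap.pi fun i => LinearMap.codRestrict (p i)
      (LinearMap.proj i ∘ₗ (Submodule.pi univ p).subtype) fun v => v.2 i (mem_univ i))
    fun v w h => by
      ext i : 2
      exact congrArg Subtype.val (congrFun h i)

/-! ### The `L²` projection onto polynomials -/

/-- The elements of `P^k(S)` as functions continuous on `S`. -/
def polyOnToContOn {d : ℕ} (k : ℕ) (S : Set (Sp d)) : polyOn k S →ₗ[ℝ] contOn S where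
  toFun f := ⟨f.1, continuousOn_of_mem_polyOn f.2⟩
  map_add' _ _ := rfl
  map_smul' _ _ := rfl

theorem IsCell.polyOn_eq_zero {d k : ℕ} {μ : Measure (Sp d)} {S : Set (Sp d)} (hS : IsCell μ S)
    {f : polyOn k S} (hf : hS.inner (polyOnToContOn k S f) (polyOnToContOn k S f) = 0) : f = 0 :=
  Subtype.ext (eq_zero_of_mem_polyOn f.2 (hS.eqOn_zero_of_inner_self hf))

theorem IsCell.exists_projection {d : ℕ} {μ : Measure (Sp d)} {S : Set (Sp d)} (hS : IsCell μ S)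
    (k : ℕ) : ∃ P : contOn S →ₗ[ℝ] polyOn k S, ∀ f ρ,
      hS.inner (polyOnToContOn k S (P f)) (polyOnToContOn k S ρ)
        = hS.inner f (polyOnToContOn k S ρ) := by
  obtain ⟨R, hR⟩ := exists_riesz
    (hS.inner.compl₁₂ (polyOnToContOn k S) (polyOnToContOn k S)) (fun f hf => hS.polyOn_eq_zero hf)
  refine ⟨R ∘ₗ hS.inner.compl₁₂ LinearMap.id (polyOnToContOn k S), fun f ρ => ?_⟩
  exact LinearMap.congr_fun (hR (hS.inner.compl₁₂ LinearMap.id (polyOnToContOn k S) f)) ρ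

/-- The `L²` projection onto `P^k(S)` as a linear map. -/
def IsCell.projection {d : ℕ} {μ : Measure (Sp d)} {S : Set (Sp d)} (hS : IsCell μ S)
    (k : ℕ) : contOn S →ₗ[ℝ] polyOn k S :=
  (hS.exists_projection k).choose

/-- The epsilon choice satisfies its specification because the linear projection does; the
difference of two such polynomials is orthogonal to itself. This makes `faceProj` linear on
continuous functions. -/
theorem faceProj_eq_projection {d k : ℕ} {F : Finset (Sp d)}
    (hF : IsCell (Measure.euclideanHausdorffMeasure (d - 1)) (hull F)) (f : contOn (hull F)) :
    faceProj k F f.1 = (hF.projection k f).1 := by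
  have hP := fun ρ => (hF.exists_projection k).choose_spec f ρ
  obtain ⟨hg, hgρ⟩ := Classical.epsilon_spec (p := fun g => g ∈ polyOn k (hull F) ∧
    ∀ ρ ∈ polyOn k (hull F), faceIntegral F (fun x => g x * ρ x)
      = faceIntegral F (fun x => f.1 x * ρ x))
    ⟨(hF.projection k f).1, (hF.projection k f).2, fun ρ hρ => hP ⟨ρ, hρ⟩⟩
  change faceProj k F f.1 ∈ _ at hg
  refine congrArg Subtype.val (sub_eq_zero.1 (hF.polyOn_eq_zero
    (f := (⟨faceProj k F f.1, hg⟩ : polyOn k (hull F)) - hF.projection k f) ?_))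
  generalize hδ : (⟨faceProj k F f.1, hg⟩ : polyOn k (hull F)) - hF.projection k f = δ
  have h2 : hF.inner (polyOnToContOn k _ ⟨faceProj k F f.1, hg⟩) (polyOnToContOn k _ δ)
    = hF.inner f (polyOnToContOn k _ δ) := hgρ δ.1 δ.2
  conv_lhs => enter [1, 2]; rw [← hδ]
  rw [map_sub, map_sub, LinearMap.sub_apply, h2, ← hP δ]
  exact sub_self _

/-! ### Continuity of polynomial vector fields, their divergence and gradients -/

theorem divergence_add {d m : ℕ} {v w : Sp d → Sp d} (hv : v ∈ polyField d m)
    (hw : w ∈ polyField d m) : divergence (v + w) = divergence v + divergence w := by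
  ext x
  have hv' := ((contDiff_of_mem_polyField hv).differentiable (by simp)).differentiableAt (x := x)
  have hw' := ((contDiff_of_mem_polyField hw).differentiable (by simp)).differentiableAt (x := x)
  simp [divergence, fderiv_add hv' hw', Finset.sum_add_distrib]

theorem divergence_smul {d m : ℕ} (c : ℝ) {v : Sp d → Sp d} (hv : v ∈ polyField d m) :
    divergence (c • v) = c • divergence v := by
  ext x
  have hv' := ((contDiff_of_mem_polyField hv).differentiable (by simp)).differentiableAt (x := x)
  simp [divergence, fderiv_const_smul hv', Finset.mul_sum]

theorem continuous_divergence {d m : ℕ} {v : Sp d → Sp d} (hv : v ∈ polyField d m) :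
    Continuous (divergence v) := by
  have h := (contDiff_of_mem_polyField hv).continuous_fderiv (by simp)
  unfold divergence
  fun_prop

/-! ### Mesh cells, traces and the bilinear forms on the finite element spaces. -/

namespace Triangulation

variable {d : ℕ} {Ω : Set (Sp d)} (T : Triangulation d Ω) (k : ℕ)

instance : FiniteDimensional ℝ (T.V k) := finiteDimensional_pi _

instance : FiniteDimensional ℝ (T.W k) := finiteDimensional_pi _

instance : FiniteDimensional ℝ (T.M k) := finiteDimensional_pi _

variable {T}

theorem isCell_element (K : T.Element) : IsCell volume (hull K.1) := by
  have h := isCell_hull (T.indep K.2.1) K.2.2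
  rwa [EuclideanSpace.euclideanHausdorffMeasure_eq_volume] at h

theorem interior_element_nonempty (K : T.Element) : (interior (hull K.1)).Nonempty :=
  interior_hull_nonempty (T.indep K.2.1) K.2.2

theorem isCell_face [NeZero d] (F : T.Face) :
    IsCell (Measure.euclideanHausdorffMeasure (d - 1)) (hull F.1) := by
  obtain ⟨hcard, K, hFK⟩ := F.2
  exact isCell_hull ((T.indep K.2.1).mono hFK) (by have := NeZero.pos d; omega)

theorem hull_element_subset (K : T.Element) : hull K.1 ⊆ closure Ω := by
  rw [← T.space_eq]
  exact T.toSimplicialComplex.convexHull_subset_space K.2.1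

theorem hull_face_subset (F : T.Face) : hull F.1 ⊆ closure Ω := by
  obtain ⟨K, hFK⟩ := F.2.2
  exact (convexHull_mono (by exact_mod_cast hFK)).trans (hull_element_subset K)

theorem mem_V {v : T.V k} (K : T.Element) : v.1 K ∈ polyField d k := v.2 K (mem_univ K)

theorem mem_W {w : T.W k} (K : T.Element) : w.1 K ∈ polyFun d (k + 1) := w.2 K (mem_univ K)

theorem mem_M {μ : T.M k} (F : T.Face) : μ.1 F ∈ polyOn k (hull F.1) := μ.2 F (mem_univ F)

/-- The restriction of the `K`-component of `w ∈ W_h` to `S`. -/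
def traceW (K : T.Element) (S : Set (Sp d)) : T.W k →ₗ[ℝ] contOn S where
  toFun w := ⟨w.1 K, (continuous_of_mem_polyFun (mem_W k K)).continuousOn⟩
  map_add' _ _ := rfl
  map_smul' _ _ := rfl

/-- The divergence of the `K`-component of `v ∈ V_h`. -/
def divV (K : T.Element) (S : Set (Sp d)) : T.V k →ₗ[ℝ] contOn S where
  toFun v := ⟨divergence (v.1 K), (continuous_divergence (mem_V k K)).continuousOn⟩
  map_add' _ _ := Subtype.ext (divergence_add (mem_V k K) (mem_V k K))
  map_smul' c _ := Subtype.ext (divergence_smul c (mem_V k K))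

/-- The scalar product of the `K`-component of `v ∈ V_h` with a fixed vector. -/
def dotV (K : T.Element) (n : Sp d) (S : Set (Sp d)) : T.V k →ₗ[ℝ] contOn S where
  toFun v := ⟨fun x => ⟪v.1 K x, n⟫_ℝ,
    ((contDiff_of_mem_polyField (mem_V k K)).continuous.inner continuous_const).continuousOn⟩
  map_add' _ _ := Subtype.ext (funext fun _ => inner_add_left _ _ _)
  map_smul' _ _ := Subtype.ext (funext fun _ => real_inner_smul_left _ _ _)

/-- The `F`-component of `μ ∈ M_h`. -/
def traceM (F : T.Face) : T.M k →ₗ[ℝ] contOn (hull F.1) where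
  toFun μ := ⟨μ.1 F, continuousOn_of_mem_polyOn (mem_M k F)⟩
  map_add' _ _ := rfl
  map_smul' _ _ := rfl

/-- The stabilization residual `Π_k^∂ w - μ` on the face `F` of `K`. -/
def residual [NeZero d] (K : T.Element) (F : T.Face) : T.W k × T.M k →ₗ[ℝ] contOn (hull F.1) :=
  (polyOnToContOn k _ ∘ₗ (isCell_face F).projection k ∘ₗ traceW k K _).coprod (-traceM k F)

theorem residual_apply [NeZero d] (K : T.Element) (F : T.Face) (w : T.W k) (μ : T.M k) (x : Sp d) :
    (residual k K F (w, μ)).1 x = faceProj k F.1 (w.1 K) x - μ.1 F x := by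
  have h := faceProj_eq_projection (k := k) (isCell_face F) (traceW k K (hull F.1) w)
  change faceProj k F.1 (w.1 K) = _ at h
  rw [h, residual, LinearMap.coprod_apply, sub_eq_add_neg]
  rfl

/-! ### The bilinear forms -/

variable (T)

/-- The `L²` inner product on `W_h`. -/
def innerW : T.W k →ₗ[ℝ] T.W k →ₗ[ℝ] ℝ :=
  ∑ K : T.Element, (isCell_element K).inner.compl₁₂ (traceW k K _) (traceW k K _)

/-- The `L²` inner product on `V_h`. -/
def innerV : T.V k →ₗ[ℝ] T.V k →ₗ[ℝ] ℝ :=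
  ∑ K : T.Element, ∑ i : Fin d, (isCell_element K).inner.compl₁₂
    (dotV k K (EuclideanSpace.single i 1) _) (dotV k K (EuclideanSpace.single i 1) _)

/-- The form `(w, ∇ · v)`. -/
def innerDiv : T.W k →ₗ[ℝ] T.V k →ₗ[ℝ] ℝ :=
  ∑ K : T.Element, (isCell_element K).inner.compl₁₂ (traceW k K _) (divV k K _)

open Classical in
/-- The form `⟨μ, v · n⟩`. -/
def innerNormal [NeZero d] : T.M k →ₗ[ℝ] T.V k →ₗ[ℝ] ℝ :=
  ∑ K : T.Element, ∑ F : T.Face with F.1 ⊆ K.1, (isCell_face F).inner.compl₁₂ (traceM k F)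
    (dotV k K (outwardNormal K.1 F.1) _)

open Classical in
/-- The stabilization form. -/
def stabilization [NeZero d] : T.W k × T.M k →ₗ[ℝ] T.W k × T.M k →ₗ[ℝ] ℝ :=
  ∑ K : T.Element, ∑ F : T.Face with F.1 ⊆ K.1, (Metric.diam (hull F.1))⁻¹ •
    (isCell_face F).inner.compl₁₂ (residual k K F) (residual k K F)

variable {T k}

theorem innerW_eq (u w : T.W k) : T.innerW k u w = T.scalarInner u.1 w.1 := by
  simp only [innerW, LinearMap.sum_apply, LinearMap.compl₁₂_apply, IsCell.inner_apply]
  rfl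

theorem innerV_eq (v w : T.V k) : T.innerV k v w = T.vectorInner v.1 w.1 := by
  simp only [innerV, LinearMap.sum_apply, LinearMap.compl₁₂_apply, IsCell.inner_apply, vectorInner]
  refine Finset.sum_congr rfl fun K _ => ?_
  rw [← integral_finsetSum]
  · refine integral_congr_ae (Filter.Eventually.of_forall fun x => ?_)
    simp [dotV, PiLp.inner_apply, mul_comm]
  · intro i _
    exact (isCell_element K).integrableOn ((dotV k K _ _ v).2.mul (dotV k K _ _ w).2)

theorem innerDiv_eq (u : T.W k) (v : T.V k) :
    T.innerDiv k u v = T.scalarInner u.1 fun K => divergence (v.1 K) := by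
  simp only [innerDiv, LinearMap.sum_apply, LinearMap.compl₁₂_apply, IsCell.inner_apply]
  rfl

theorem innerNormal_eq [NeZero d] (μ : T.M k) (v : T.V k) : T.innerNormal k μ v =
    T.bdry fun K F x => μ.1 F x * ⟪v.1 K x, outwardNormal K.1 F.1⟫_ℝ := by
  simp only [innerNormal, LinearMap.sum_apply, LinearMap.compl₁₂_apply, IsCell.inner_apply]
  rfl

theorem stabilization_eq [NeZero d] (u w : T.W k) (l μ : T.M k) :
    T.stabilization k (u, l) (w, μ) = T.bdry fun K F x => (Metric.diam (hull F.1))⁻¹ *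
        (faceProj k F.1 (u.1 K) x - l.1 F x) * (faceProj k F.1 (w.1 K) x - μ.1 F x) := by
  simp only [stabilization, LinearMap.sum_apply, LinearMap.smul_apply, LinearMap.compl₁₂_apply,
    IsCell.inner_apply, residual_apply, smul_eq_mul, bdry, faceIntegral, mul_assoc,
    integral_const_mul]

theorem innerW_comm (u w : T.W k) : T.innerW k u w = T.innerW k w u := by
  simp only [innerW, LinearMap.sum_apply, LinearMap.compl₁₂_apply, IsCell.inner_comm]

theorem innerV_comm (v w : T.V k) : T.innerV k v w = T.innerV k w v := by
  simp only [innerV_eq, vectorInner, real_inner_comm]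

theorem stabilization_comm [NeZero d] (x y : T.W k × T.M k) :
    T.stabilization k x y = T.stabilization k y x := by
  simp only [stabilization, LinearMap.sum_apply, LinearMap.smul_apply, LinearMap.compl₁₂_apply,
    IsCell.inner_comm]

theorem W_eq_zero {w : T.W k} (h : ∀ K : T.Element, ∀ x ∈ hull K.1, w.1 K x = 0) : w = 0 :=
  Subtype.ext <| funext fun K =>
    eq_zero_of_mem_polyFun (mem_W k K) (interior_element_nonempty K) (h K)

theorem innerW_definite (w : T.W k) (h : T.innerW k w w = 0) : w = 0 := by
  simp only [innerW, LinearMap.sum_apply, LinearMap.compl₁₂_apply] at h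
  rw [Finset.sum_eq_zero_iff_of_nonneg fun K _ => (isCell_element K).inner_self_nonneg _] at h
  exact W_eq_zero fun K => (isCell_element K).eqOn_zero_of_inner_self (h K (Finset.mem_univ K))

theorem innerV_nonneg (v : T.V k) : 0 ≤ T.innerV k v v := by
  simp only [innerV, LinearMap.sum_apply, LinearMap.compl₁₂_apply]
  exact Finset.sum_nonneg fun K _ => Finset.sum_nonneg fun i _ =>
    (isCell_element K).inner_self_nonneg _

theorem innerV_definite (v : T.V k) (h : T.innerV k v v = 0) : v = 0 := by
  simp only [innerV, LinearMap.sum_apply, LinearMap.compl₁₂_apply] at h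
  rw [Finset.sum_eq_zero_iff_of_nonneg fun K _ => Finset.sum_nonneg fun i _ =>
    (isCell_element K).inner_self_nonneg _] at h
  refine Subtype.ext <| funext fun K => ?_
  have hK := h K (Finset.mem_univ K)
  rw [Finset.sum_eq_zero_iff_of_nonneg fun i _ => (isCell_element K).inner_self_nonneg _] at hK
  ext x i
  refine congrFun (eq_zero_of_mem_polyFun (mem_V k K i) (interior_element_nonempty K)
    fun y hy => ?_) x
  simpa [dotV, PiLp.inner_apply] using (isCell_element K).eqOn_zero_of_inner_self (hK i (Finset.mem_univ i)) y hy

theorem stabilization_nonneg [NeZero d] (x : T.W k × T.M k) : 0 ≤ T.stabilization k x x := by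
  simp only [stabilization, LinearMap.sum_apply, LinearMap.smul_apply, LinearMap.compl₁₂_apply]
  exact Finset.sum_nonneg fun K _ => Finset.sum_nonneg fun F _ =>
    mul_nonneg (inv_nonneg.2 Metric.diam_nonneg) ((isCell_face F).inner_self_nonneg _)

/-- The stabilization form controls the trace. -/
theorem stabilization_definite (hd : 2 ≤ d) [NeZero d] (μ : T.M k)
    (h : T.stabilization k (0, μ) (0, μ) = 0) : μ = 0 := by
  have hnn : ∀ (K : T.Element) (F : T.Face), 0 ≤ (Metric.diam (hull F.1))⁻¹ *
      (isCell_face F).inner (residual k K F (0, μ)) (residual k K F (0, μ)) := fun K F =>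
    mul_nonneg (inv_nonneg.2 Metric.diam_nonneg) ((isCell_face F).inner_self_nonneg _)
  simp only [stabilization, LinearMap.sum_apply, LinearMap.smul_apply, LinearMap.compl₁₂_apply,
    smul_eq_mul] at h
  rw [Finset.sum_eq_zero_iff_of_nonneg fun K _ => Finset.sum_nonneg fun F _ => hnn K F] at h
  refine Subtype.ext <| funext fun F => ?_
  obtain ⟨hcard, K, hFK⟩ := F.2
  have hK := h K (Finset.mem_univ K)
  rw [Finset.sum_eq_zero_iff_of_nonneg fun F _ => hnn K F] at hK
  -- A face has `d ≥ 2` vertices, hence positive diameter, so its weight is not the inverse of zero.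
  have hF := (mul_eq_zero.1 (hK F (by simpa using hFK))).resolve_left
    (inv_ne_zero (diam_hull_pos (hd.trans hcard.ge)).ne')
  refine eq_zero_of_mem_polyOn (mem_M k F) fun x hx => ?_
  have hx0 := (isCell_face F).eqOn_zero_of_inner_self hF x hx
  simpa [residual, traceM] using hx0

variable (T k)

/-- The form `A` as a bilinear form. -/
def bilinA [NeZero d] (α : ℝ) :
    T.V k × T.W k × T.M k →ₗ[ℝ] T.V k × T.W k × T.M k →ₗ[ℝ] ℝ :=
  let πV := LinearMap.fst ℝ (T.V k) (T.W k × T.M k)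
  let πWM := LinearMap.snd ℝ (T.V k) (T.W k × T.M k)
  let D := (T.innerDiv k).compl₁₂ (LinearMap.fst ℝ _ _ ∘ₗ πWM) πV
  let N := (T.innerNormal k).compl₁₂ (LinearMap.snd ℝ _ _ ∘ₗ πWM) πV
  (T.innerV k).compl₁₂ πV πV - D + N + D.flip - N.flip
    + α • (T.stabilization k).compl₁₂ πWM πWM

variable {T k}

theorem bilinA_apply [NeZero d] (α : ℝ) (q r : T.V k) (u w : T.W k) (l μ : T.M k) :
    T.bilinA k α (q, u, l) (r, w, μ) = T.innerV k q r - T.innerDiv k u r + T.innerNormal k l r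
      + T.innerDiv k w q - T.innerNormal k μ q + α * T.stabilization k (u, l) (w, μ) := rfl

theorem bilinA_eq [NeZero d] (α : ℝ) (q r : T.V k) (u w : T.W k) (l μ : T.M k) :
    T.bilinA k α (q, u, l) (r, w, μ) = T.formA k α q.1 u.1 l.1 r.1 w.1 μ.1 := by
  rw [bilinA_apply, formA, innerV_eq, innerDiv_eq, innerNormal_eq, innerDiv_eq, innerNormal_eq,
    stabilization_eq]
  simp only [scalarInner, mul_comm]

/-- The divergence and normal couplings enter with opposite signs: they cancel on the diagonal and
become symmetric once the test flux is negated. -/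
theorem isMixedForm_bilinA (hd : 2 ≤ d) [NeZero d] {α : ℝ} (hα : 0 < α) :
    IsMixedForm (T.bilinA k α) where
  nonneg := by
    rintro ⟨q, u, l⟩
    rw [bilinA_apply]
    have h1 := innerV_nonneg q
    have h2 := mul_nonneg hα.le (stabilization_nonneg (u, l))
    linarith
  definite := by
    intro q μ h
    rw [bilinA_apply] at h
    have h1 := innerV_nonneg q
    have h2 := mul_nonneg hα.le (stabilization_nonneg ((0 : T.W k), μ))
    refine ⟨innerV_definite q (by linarith), stabilization_definite hd μ ?_⟩
    exact (mul_eq_zero.1 (by linarith : α * T.stabilization k (0, μ) (0, μ) = 0)).resolve_left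
      hα.ne'
  symm := by
    intro q u l r w μ
    simp only [bilinA_apply, map_neg, innerV_comm q r, stabilization_comm (u, l) (w, μ)]
    ring

end Triangulation

/-! ### Gradients of polynomials and scalar inequalities for the cubic nonlinearity. -/

theorem gradient_add_of_mem_polyFun {d m : ℕ} {f g : Sp d → ℝ} (hf : f ∈ polyFun d m)
    (hg : g ∈ polyFun d m) (x : Sp d) : ∇ (f + g) x = ∇ f x + ∇ g x := by
  simp [gradient, fderiv_add (differentiable_of_mem_polyFun hf x)
    (differentiable_of_mem_polyFun hg x)]

theorem gradient_smul_of_mem_polyFun {d m : ℕ} (c : ℝ) {f : Sp d → ℝ} (hf : f ∈ polyFun d m)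
    (x : Sp d) : ∇ (c • f) x = c • ∇ f x := by
  simp [gradient, fderiv_const_smul (differentiable_of_mem_polyFun hf x)]

theorem continuous_gradient_of_mem_polyFun {d m : ℕ} {f : Sp d → ℝ} (hf : f ∈ polyFun d m) :
    Continuous (∇ f) :=
  (LinearIsometryEquiv.continuous _).comp ((contDiff_of_mem_polyFun hf).continuous_fderiv (by simp))

/-- The convexity inequality for the fourth power. -/
theorem fourth_power_convex (x y : ℝ) {s t : ℝ} (hs : 0 ≤ s) (ht : 0 ≤ t) (hst : s + t = 1) :
    (s * x + t * y) ^ 4 ≤ s * x ^ 4 + t * y ^ 4 :=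
  (Even.convexOn_pow (n := 4) (by decide)).2 (mem_univ x) (mem_univ y) hs ht hst

theorem cube_sub_cube_mul_nonneg (x y : ℝ) : 0 ≤ (x ^ 3 - y ^ 3) * (x - y) := by
  have : (x ^ 3 - y ^ 3) * (x - y) = (x - y) ^ 2 * (x ^ 2 + x * y + y ^ 2) := by ring
  rw [this]
  exact mul_nonneg (sq_nonneg _) (by nlinarith [sq_nonneg (x + y), sq_nonneg x, sq_nonneg y])

theorem eq_of_cube_sub_cube_mul_eq_zero {x y : ℝ} (h : (x ^ 3 - y ^ 3) * (x - y) = 0) : x = y := by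
  rcases mul_eq_zero.1 h with h | h
  · exact (Odd.strictMono_pow (by decide : Odd 3)).injective (sub_eq_zero.1 h)
  · exact sub_eq_zero.1 h

/-! ### Data functionals, the initial value, the quartic energy and the time step. -/

namespace Triangulation

variable {d : ℕ} {Ω : Set (Sp d)} {T : Triangulation d Ω} {k : ℕ}

/-- The convection form is linear in the test function. -/
theorem exists_linear_formB [NeZero d] {β : Sp d → Sp d} (hβ : ContinuousOn β (closure Ω))
    (u : T.W k) (l : T.M k) : ∃ b : T.W k →ₗ[ℝ] ℝ, ∀ w, b w = T.formB β u.1 l.1 w.1 := by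
  classical
  let c : ∀ K : T.Element, T.W k →ₗ[ℝ] contOn (hull K.1) := fun K =>
    { toFun := fun w => ⟨fun x => ⟪u.1 K x • β x, ∇ (w.1 K) x⟫_ℝ,
        ((continuous_of_mem_polyFun (mem_W k K)).continuousOn.smul
          (hβ.mono (hull_element_subset K))).inner
          (continuous_gradient_of_mem_polyFun (mem_W k K)).continuousOn⟩
      map_add' := fun w w' => Subtype.ext <| funext fun x => by
        have h := gradient_add_of_mem_polyFun (mem_W k K (w := w)) (mem_W k K (w := w')) x
        exact (congrArg _ h).trans (inner_add_right _ _ _)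
      map_smul' := fun a w => Subtype.ext <| funext fun x => by
        have h := gradient_smul_of_mem_polyFun a (mem_W k K (w := w)) x
        exact (congrArg _ h).trans (real_inner_smul_right _ _ _) }
  let g : ∀ (K : T.Element) (F : T.Face), contOn (hull F.1) := fun K F =>
    ⟨fun x => ⟪β x, outwardNormal K.1 F.1⟫_ℝ * l.1 F x,
      ((hβ.mono (hull_face_subset F)).inner continuousOn_const).mul
        (continuousOn_of_mem_polyOn (mem_M k F))⟩
  refine ⟨-(∑ K : T.Element, (isCell_element K).integral ∘ₗ c K) +
    ∑ K : T.Element, ∑ F : T.Face with F.1 ⊆ K.1,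
      (isCell_face F).inner (g K F) ∘ₗ traceW k K _, fun w => ?_⟩
  simp only [LinearMap.add_apply, LinearMap.neg_apply, LinearMap.sum_apply, LinearMap.comp_apply,
    IsCell.inner_apply, formB, vectorInner, bdry, faceIntegral]
  congr! 4

/-- The `L²` pairing of a square integrable function with `W_h` is linear. -/
theorem exists_linear_scalarInner (hΩ : Convex ℝ Ω) {u₀ : Sp d → ℝ}
    (hu : MemLp u₀ 2 (volume.restrict Ω)) :
    ∃ b : T.W k →ₗ[ℝ] ℝ, ∀ w, b w = T.scalarInner (fun _ => u₀) w.1 := by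
  -- The elements fill the closure of Ω, while the datum is square integrable on Ω; the frontier of
  -- a convex set is null.
  have hae : volume.restrict (closure Ω) = volume.restrict Ω := by
    refine (Measure.restrict_congr_set ?_)
    refine Filter.EventuallyLE.antisymm ?_ subset_closure.eventuallyLE
    refine ae_le_set.2 (measure_mono_null ?_ (hΩ.addHaar_frontier volume))
    exact sdiff_subset_sdiff_right interior_subset
  have hint : ∀ (K : T.Element) (w : T.W k),
      IntegrableOn (fun x => u₀ x * w.1 K x) (hull K.1) volume := by
    intro K w
    have hcell := isCell_element K
    have h2 : MemLp u₀ 2 (volume.restrict (hull K.1)) :=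
      (hae ▸ hu).mono_measure (Measure.restrict_mono (hull_element_subset K) le_rfl)
    have : IsFiniteMeasure (volume.restrict (hull K.1)) :=
      ⟨by simpa using hcell.measure_ne_top.lt_top⟩
    exact IntegrableOn.mul_continuousOn (h2.integrable (by norm_num))
      (continuous_of_mem_polyFun (mem_W k K)).continuousOn hcell.isCompact
  exact ⟨
    { toFun := fun w => T.scalarInner (fun _ => u₀) w.1
      map_add' := fun w w' => by
        simp only [scalarInner, ← Finset.sum_add_distrib]
        refine Finset.sum_congr rfl fun K _ => ?_
        rw [← integral_add (hint K w) (hint K w')]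
        simp [mul_add]
      map_smul' := fun a w => by
        simp only [scalarInner, RingHom.id_apply, smul_eq_mul, Finset.mul_sum,
          ← integral_const_mul]
        simp [mul_left_comm] }, fun w => rfl⟩

theorem existsUnique_initialValue (hΩ : Convex ℝ Ω) {u₀ : Sp d → ℝ}
    (hu : MemLp u₀ 2 (volume.restrict Ω)) : ∃! u₀h : T.W k, T.IsInitialValue k u₀ u₀h := by
  obtain ⟨b, hb⟩ := exists_linear_scalarInner (T := T) (k := k) hΩ hu
  obtain ⟨R, hR⟩ := exists_riesz (T.innerW k) innerW_definite
  have hiff : ∀ v, T.IsInitialValue k u₀ v ↔ T.innerW k v = b := fun v => by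
    simp only [IsInitialValue, LinearMap.ext_iff, innerW_eq, hb, sub_eq_zero]
  refine ⟨R b, (hiff _).2 (hR b), fun v hv => ?_⟩
  refine sub_eq_zero.1 (innerW_definite _ ?_)
  have h : T.innerW k (v - R b) = 0 := by rw [map_sub, (hiff v).1 hv, hR, sub_self]
  rw [h, LinearMap.zero_apply]

/-- The potential energy `∫ (u⁴ / 4 - p u)`. -/
def energy (p u : T.W k) : ℝ :=
  ∑ K : T.Element, (isCell_element K).integral
    ((1 / 4 : ℝ) • traceW k K _ u ^ 4 - traceW k K _ p * traceW k K _ u)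

/-- The derivative of the potential energy. -/
def energyDeriv (p u : T.W k) : T.W k →ₗ[ℝ] ℝ :=
  ∑ K : T.Element, (isCell_element K).inner (traceW k K _ u ^ 3 - traceW k K _ p) ∘ₗ traceW k K _

theorem energyDeriv_apply (p u w : T.W k) :
    energyDeriv p u w = T.scalarInner (fun K x => u.1 K x ^ 3 - p.1 K x) w.1 := by
  simp only [energyDeriv, LinearMap.sum_apply, LinearMap.comp_apply, IsCell.inner_apply]
  rfl

theorem convexOn_energy (p : T.W k) : ConvexOn ℝ univ (energy p) := by
  refine ⟨convex_univ, fun u _ v _ s t hs ht hst => ?_⟩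
  simp only [energy, smul_eq_mul, Finset.mul_sum, ← Finset.sum_add_distrib]
  refine Finset.sum_le_sum fun K _ => ?_
  simp only [← smul_eq_mul, ← map_smul, ← map_add]
  refine (isCell_element K).integral_mono fun x _ => ?_
  have h := fourth_power_convex (u.1 K x) (v.1 K x) hs ht hst
  change 1 / 4 * (s * u.1 K x + t * v.1 K x) ^ 4 - p.1 K x * (s * u.1 K x + t * v.1 K x) ≤
    s * (1 / 4 * u.1 K x ^ 4 - p.1 K x * u.1 K x) + t * (1 / 4 * v.1 K x ^ 4 - p.1 K x * v.1 K x)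
  linarith

/-- Pointwise, u⁴/4 ≥ u²/2 − 1/4 and pu ≤ (u² + p²)/2. -/
theorem energy_bounded_below (p : T.W k) : ∃ b, ∀ u, b ≤ energy p u := by
  refine ⟨∑ K : T.Element, (isCell_element K).integral
    (-(1 / 4 : ℝ) • 1 - (1 / 2 : ℝ) • traceW k K _ p ^ 2), fun u => ?_⟩
  refine Finset.sum_le_sum fun K _ => (isCell_element K).integral_mono fun x _ => ?_
  change -(1 / 4) * 1 - 1 / 2 * p.1 K x ^ 2 ≤ 1 / 4 * u.1 K x ^ 4 - p.1 K x * u.1 K x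
  nlinarith [sq_nonneg (u.1 K x ^ 2 - 1), sq_nonneg (u.1 K x - p.1 K x)]

/-- Along a line the energy is a quartic polynomial in `t` with integrals as coefficients, so no
differentiation under the integral is needed. -/
theorem hasDerivAt_energy (p u w : T.W k) :
    HasDerivAt (fun t : ℝ => energy p (u + t • w)) (energyDeriv p u w) 0 := by
  simp only [energy, energyDeriv, LinearMap.sum_apply, LinearMap.comp_apply]
  refine HasDerivAt.fun_sum fun K _ => ?_
  generalize isCell_element K = hK
  set U := traceW k K (hull K.1) u
  set P := traceW k K (hull K.1) p
  set Y := traceW k K (hull K.1) w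
  have hexp : ∀ t : ℝ, hK.integral ((1 / 4 : ℝ) • traceW k K _ (u + t • w) ^ 4
      - P * traceW k K _ (u + t • w)) = hK.integral ((1 / 4 : ℝ) • U ^ 4 - P * U)
      + (t * hK.inner (U ^ 3 - P) Y + t ^ 2 * (hK.integral ((3 / 2 : ℝ) • (U ^ 2 * Y ^ 2))
        + t * hK.integral (U * Y ^ 3) + t ^ 2 * hK.integral ((1 / 4 : ℝ) • Y ^ 4))) := by
    intro t
    rw [IsCell.inner_eq]
    simp only [mul_add, ← mul_assoc, ← pow_add, ← pow_succ]
    simp only [← smul_eq_mul (a := (_ : ℝ)), ← map_smul, ← map_add]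
    congr 1
    ext x
    change 1 / 4 * (U.1 x + t * Y.1 x) ^ 4 - P.1 x * (U.1 x + t * Y.1 x) =
      (1 / 4 * U.1 x ^ 4 - P.1 x * U.1 x) + (t * ((U.1 x ^ 3 - P.1 x) * Y.1 x)
        + (t ^ 2 * (3 / 2 * (U.1 x ^ 2 * Y.1 x ^ 2)) + t ^ (2 + 1) * (U.1 x * Y.1 x ^ 3)
        + t ^ (2 + 2) * (1 / 4 * Y.1 x ^ 4)))
    ring
  simp only [hexp]
  generalize hK.integral ((3 / 2 : ℝ) • (U ^ 2 * Y ^ 2)) = c₂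
  generalize hK.integral (U * Y ^ 3) = c₃
  generalize hK.integral ((1 / 4 : ℝ) • Y ^ 4) = c₄
  have hid := hasDerivAt_id (0 : ℝ)
  have h := ((hid.mul_const (hK.inner (U ^ 3 - P) Y)).add ((hid.pow 2).mul
    (((hid.mul_const c₃).const_add c₂).add ((hid.pow 2).mul_const c₄)))).const_add
      (hK.integral ((1 / 4 : ℝ) • U ^ 4 - P * U))
  convert! h using 1
  simp

/-- The contribution of `p` cancels, so monotonicity reduces to that of the cube. -/
theorem energyDeriv_sub (p u v : T.W k) :
    energyDeriv p u (u - v) - energyDeriv p v (u - v) = ∑ K : T.Element, (isCell_element K).integral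
      ((traceW k K _ u ^ 3 - traceW k K _ v ^ 3) * (traceW k K _ u - traceW k K _ v)) := by
  simp only [energyDeriv, LinearMap.sum_apply, LinearMap.comp_apply, ← Finset.sum_sub_distrib,
    IsCell.inner_eq]
  refine Finset.sum_congr rfl fun K _ => ?_
  rw [← map_sub, map_sub (traceW k K _)]
  congr 1
  ring

theorem energyDeriv_monotone (p u v : T.W k) :
    0 ≤ energyDeriv p u (u - v) - energyDeriv p v (u - v) := by
  rw [energyDeriv_sub]
  exact Finset.sum_nonneg fun K _ =>
    (isCell_element K).integral_nonneg fun x _ => cube_sub_cube_mul_nonneg _ _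

theorem energyDeriv_injective (p u v : T.W k)
    (h : energyDeriv p u (u - v) - energyDeriv p v (u - v) = 0) : u = v := by
  rw [energyDeriv_sub, Finset.sum_eq_zero_iff_of_nonneg fun K _ =>
    (isCell_element K).integral_nonneg fun x _ => cube_sub_cube_mul_nonneg _ _] at h
  refine sub_eq_zero.1 (W_eq_zero fun K x hx => sub_eq_zero.2 ?_)
  exact eq_of_cube_sub_cube_mul_eq_zero ((isCell_element K).eqOn_zero
    (Subtype.prop ((traceW k K _ u ^ 3 - traceW k K _ v ^ 3) * (traceW k K _ u - traceW k K _ v)))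
    (fun x _ => cube_sub_cube_mul_nonneg _ _) (h K (Finset.mem_univ K)) x hx)

theorem existsUnique_stepSolution (hd : 2 ≤ d) {α Pe ε Δt : ℝ} (hα : 0 < α) (hPe : 0 < Pe)
    (hε : 0 < ε) (hΔt : 0 < Δt) {β : Sp d → Sp d} (hβ : ContinuousOn β (closure Ω))
    (uPrev : T.W k) (uhatPrev : T.M k) :
    ∃! s : T.Unknowns k, T.IsStepSolution k α Pe ε Δt β uPrev uhatPrev s := by
  have : NeZero d := ⟨by omega⟩
  obtain ⟨b, hb⟩ := exists_linear_formB hβ uPrev uhatPrev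
  obtain ⟨lb, hlb⟩ := energy_bounded_below uPrev
  -- The evolution equation is multiplied by `Δt`, whence the coefficient `Δt * (1 / Pe)` and the
  -- right-hand side `T.innerW k uPrev - Δt • b`.
  have hmain := (isMixedForm_bilinA (T := T) (k := k) hd hα).existsUnique (T.innerW k) innerW_comm
    innerW_definite (convexOn_energy uPrev) hlb (energyDeriv uPrev) (hasDerivAt_energy uPrev)
    (energyDeriv_monotone uPrev) (energyDeriv_injective uPrev)
    (c := Δt * (1 / Pe)) (e := ε ^ 2) (by positivity) (by positivity)
    (T.innerW k uPrev - Δt • b)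
  have hdiff : ∀ u w : T.W k, T.scalarInner (fun K x => (u.1 K x - uPrev.1 K x) / Δt) w.1
      = Δt⁻¹ * (T.innerW k u w - T.innerW k uPrev w) := by
    intro u w
    rw [← LinearMap.sub_apply, ← map_sub, ← smul_eq_mul, ← LinearMap.smul_apply, ← map_smul,
      innerW_eq]
    congr 1
    ext K x
    exact div_eq_inv_mul _ _
  have hiff : ∀ s : T.Unknowns k, T.IsStepSolution k α Pe ε Δt β uPrev uhatPrev s ↔
      (∀ y : T.V k × T.W k × T.M k, T.innerW k s.u y.2.1
        + Δt * (1 / Pe) * T.bilinA k α (s.p, s.φ, s.φhat) y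
        = (T.innerW k uPrev - Δt • b) y.2.1) ∧
      ∀ y : T.V k × T.W k × T.M k, energyDeriv uPrev s.u y.2.1
        + ε ^ 2 * T.bilinA k α (s.q, s.u, s.uhat) y - T.innerW k s.φ y.2.1 = 0 := by
    intro s
    have key : ∀ x A B c : ℝ, Δt⁻¹ * (x - c) + 1 / Pe * A + B = 0 ↔
        x + Δt * (1 / Pe) * A = c - Δt * B := by
      intro x A B c
      rw [← mul_right_inj' hΔt.ne', mul_zero, ← sub_eq_zero (b := c - Δt * B)]
      refine Eq.congr_left ?_
      field_simp
      ring
    have h1 : ∀ (r : T.V k) (w : T.W k) (μ : T.M k),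
        (T.scalarInner (fun K x => (s.u.1 K x - uPrev.1 K x) / Δt) w.1
          + 1 / Pe * T.formA k α s.p.1 s.φ.1 s.φhat.1 r.1 w.1 μ.1
          + T.formB β uPrev.1 uhatPrev.1 w.1 = 0) ↔ (T.innerW k s.u w
          + Δt * (1 / Pe) * T.bilinA k α (s.p, s.φ, s.φhat) (r, w, μ)
          = (T.innerW k uPrev - Δt • b) w) := fun r w μ => by
      rw [hdiff, ← hb, ← bilinA_eq, key]
      rfl
    have h2 : ∀ (r : T.V k) (w : T.W k) (μ : T.M k),
        (T.scalarInner (fun K x => s.u.1 K x ^ 3 - uPrev.1 K x) w.1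
          + ε ^ 2 * T.formA k α s.q.1 s.u.1 s.uhat.1 r.1 w.1 μ.1 - T.scalarInner s.φ.1 w.1 = 0) ↔
        (energyDeriv uPrev s.u w + ε ^ 2 * T.bilinA k α (s.q, s.u, s.uhat) (r, w, μ)
          - T.innerW k s.φ w = 0) := fun r w μ => by
      rw [energyDeriv_apply, bilinA_eq, innerW_eq]
    exact ⟨fun h => ⟨fun y => (h1 _ _ _).1 (h.evolution y.1 y.2.1 y.2.2),
      fun y => (h2 _ _ _).1 (h.potential y.1 y.2.1 y.2.2)⟩,
      fun h => ⟨fun r w μ => (h1 r w μ).2 (h.1 (r, w, μ)),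
        fun r w μ => (h2 r w μ).2 (h.2 (r, w, μ))⟩⟩
  obtain ⟨⟨⟨p, φ, φhat⟩, ⟨q, u, uhat⟩⟩, hs, huniq⟩ := hmain
  refine ⟨⟨p, φ, φhat, q, u, uhat⟩, (hiff _).2 hs, fun s hs' => ?_⟩
  have h := huniq ((s.p, s.φ, s.φhat), (s.q, s.u, s.uhat)) ((hiff s).1 hs')
  simp only [Prod.mk.injEq] at h
  obtain ⟨⟨rfl, rfl, rfl⟩, rfl, rfl, rfl⟩ := h
  rfl

end Triangulation

end HDG
end

theorem theorem3p1 (d : ℕ) (hd : d = 2 ∨ d = 3) (Ω : Set (HDG.Sp d))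
    (hΩ : HDG.IsConvexPolytopalDomain Ω) (T : HDG.Triangulation d Ω) (k : ℕ)
    (α Pe ε tEnd : ℝ) (hα : 0 < α) (hPe : 0 < Pe) (hε : 0 < ε) (htEnd : 0 < tEnd)
    (N : ℕ) (hN : 1 ≤ N) (β : HDG.Sp d → HDG.Sp d) (hβ : HDG.IsAdmissibleVelocity Ω β) :
    (∀ u₀ : HDG.Sp d → ℝ, MeasureTheory.MemLp u₀ 2 (MeasureTheory.volume.restrict Ω) →
      ∃! u₀h : T.W k, T.IsInitialValue k u₀ u₀h) ∧
    (∀ n ∈ Finset.Icc 1 N, ∀ (uPrev : T.W k) (uhatPrev : T.M k),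
      ∃! s : T.Unknowns k, T.IsStepSolution k α Pe ε (tEnd / N) β uPrev uhatPrev s) := by
  refine ⟨fun u₀ hu => HDG.Triangulation.existsUnique_initialValue hΩ.convex hu,
    fun n _ uPrev uhatPrev => ?_⟩
  have hN' : (0 : ℝ) < N := by exact_mod_cast hN
  exact HDG.Triangulation.existsUnique_stepSolution (by omega) hα hPe hε (div_pos htEnd hN')
    hβ.continuousOn uPrev uhatPrev
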